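/- Let $\mathbb{S}^n\subset\mathbb{R}^{n+1}$ be the unit sphere with its geodesic distance $d$ and its $n$-dimensional volume $vol$. For $A\subset\mathbb{S}^n$ and $\rho>0$ put $A+\rho=\{y : d(x,y)\le\rho \text{ for some } x\in A\}$, let $B(x,\rho)$ be the open geodesic ball, and let $\mathbb{S}^{n-\ell}\subset\mathbb{S}^n$ be an equatorial $(n-\ell)$-sphere. A set $S\subset\mathbb{S}^n$ is convex if it lies in a hemisphere and the cone over it with vertex $0$ is convex; convex hulls in $\mathbb{S}^n$ are taken through cones. Let $\mathcal{MC}$ be the vague closure, in the space of Borel probability measures on $\mathbb{S}^n$, of the set of measures $\mu_S=vol_{|S}/vol(S)$ with $S$ nonempty, open and convex, and let $\mathcal{MC}^{\ell}$ be the set of those $\mu\in\mathcal{MC}$ whose support (a closed convex set) has dimension $\ell$. A finite convex partition, that is, a finite family of pairwise disjoint nonempty open convex sets covering $\mathbb{S}^n$ up to a null set, is identified with the probability measure $\sum_{S}\frac{vol(S)}{vol(\mathbb{S}^n)}\delta_{\mu_S}$ on $\mathcal{MC}$. Let $\mathcal{CP}$, the space of convex partitions, be the vague closure of the set of these measures in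 the space of Borel probability measures on $\mathcal{MC}$. A convex partition $\Pi\in\mathcal{CP}$ has dimension $\le k$ if its support is contained in $\bigcup_{\ell=0}^{k}\mathcal{MC}^{\ell}$. For $\mu\in\mathcal{MC}$ and $r>0$ let $M_r(\mu)$ be the set of points of $\mathrm{support}(\mu)$ at which $x\mapsto\mu(B(x,r))$ attains its maximum over $\mathrm{support}(\mu)$. For a continuous map $f:\mathbb{S}^n\to\mathbb{R}^k$, a convex partition $\Pi$ is $r$-adapted to $f$ if there is $z\in\mathbb{R}^k$ such that $f^{-1}(z)$ meets the convex hull of $M_r(\mu)$ for every $\mu$ in the support of $\Pi$. Proposition. For every $n$ there are constants $c=c(n)>0$ and $r_0=r_0(n)>0$ such that the following holds. Let $k\le n$, let $f:\mathbb{S}^n\to\mathbb{R}^k$ be continuous, let $0<r\le r_0$, and let $\Pi$ be a convex partition of dimension $\le k$ which is $r$-adapted to $f$. Then $$\max_{z\in\mathbb{R}^k} vol\Big(f^{-1}(z)+\frac{r}{c}\Big)\ \ge\ c\,\sum_{\ell=0}^{k} vol\big(\mathbb{S}^{n-\ell}+cr\big)\,\Pi(\mathcal{MC}^{\ell}),$$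 and the maximum on the left is attained. -/

import Mathlib

open MeasureTheory
open scoped ENNReal

noncomputable section

namespace SphereWaist

/-- The unit sphere `S^n` in `ℝ^(n+1)`. -/
abbrev Sphere (n : ℕ) : Type :=
  Metric.sphere (0 : EuclideanSpace ℝ (Fin (n + 1))) 1

/-- The canonical `n`-dimensional (surface) measure of `S^n`. -/
def vol (n : ℕ) : Measure (Sphere n) :=
  (volume : Measure (EuclideanSpace ℝ (Fin (n + 1)))).toSphere

/-- The geodesic distance of the round unit sphere. -/
def geoDist {n : ℕ} (x y : Sphere n) : ℝ :=
  InnerProductGeometry.angle (x : EuclideanSpace ℝ (Fin (n + 1))) y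

/-- The geodesic ball `B(x, r)`. -/
def geoBall {n : ℕ} (x : Sphere n) (r : ℝ) : Set (Sphere n) :=
  {y | geoDist x y < r}

/-- The tubular neighbourhood `A + r`: the points at geodesic distance at most `r`
from some point of `A`. -/
def tube {n : ℕ} (A : Set (Sphere n)) (r : ℝ) : Set (Sphere n) :=
  {y | ∃ x ∈ A, geoDist x y ≤ r}

/-- The equatorial `d`-dimensional subsphere of `S^n` (for `d ≤ n`), on which only the first
`d + 1` coordinates may be nonzero. -/
def equator (n d : ℕ) : Set (Sphere n) :=
  {x | ∀ i : Fin (n + 1), d < (i : ℕ) → (x : EuclideanSpace ℝ (Fin (n + 1))) i = 0}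

/-- The cone over `S` with vertex at the origin. -/
def coneOver {n : ℕ} (S : Set (Sphere n)) : Set (EuclideanSpace ℝ (Fin (n + 1))) :=
  {p | ∃ t : ℝ, 0 ≤ t ∧ ∃ x ∈ S, p = t • (x : EuclideanSpace ℝ (Fin (n + 1)))}

/-- A subset of the sphere is convex if it lies in a (closed) hemisphere and the cone over it
is convex. -/
def IsSphConvex {n : ℕ} (S : Set (Sphere n)) : Prop :=
  (∃ v : Sphere n, ∀ x ∈ S, 0 ≤ inner ℝ (v : EuclideanSpace ℝ (Fin (n + 1))) x) ∧
    Convex ℝ (coneOver S)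

/-- The convex hull of a subset of the sphere, taken through cones. -/
def sphHull {n : ℕ} (A : Set (Sphere n)) : Set (Sphere n) :=
  {y | (y : EuclideanSpace ℝ (Fin (n + 1))) ∈ convexHull ℝ (coneOver A)}

/-- The uniform probability measures `vol|_S / vol(S)` of nonempty open convex sets `S`. -/
def uniformConvex (n : ℕ) : Set (ProbabilityMeasure (Sphere n)) :=
  {μ | ∃ S : Set (Sphere n), IsOpen S ∧ S.Nonempty ∧ IsSphConvex S ∧
    (μ : Measure (Sphere n)) = (vol n S)⁻¹ • (vol n).restrict S}

/-- The space `MC` of convexly derived probability measures: the vague (= weak, the sphere being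
compact) closure of the uniform measures of open convex sets. -/
def MC (n : ℕ) : Type :=
  closure (uniformConvex n)

instance (n : ℕ) : TopologicalSpace (MC n) :=
  inferInstanceAs (TopologicalSpace (closure (uniformConvex n)))

instance (n : ℕ) : MeasurableSpace (MC n) :=
  borel (MC n)

instance (n : ℕ) : BorelSpace (MC n) :=
  ⟨rfl⟩

/-- The underlying measure on the sphere of a convexly derived measure. -/
def MC.toMeasure {n : ℕ} (μ : MC n) : Measure (Sphere n) :=
  ((μ.1 : ProbabilityMeasure (Sphere n)) : Measure (Sphere n))

/-- `MC^ℓ`: the convexly derived measures with `ℓ`-dimensional support. The dimension of a convex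
set in the sphere is the linear dimension of the cone over it minus one. -/
def MCdim (n l : ℕ) : Set (MC n) :=
  {μ | Module.finrank ℝ (Submodule.span ℝ (coneOver μ.toMeasure.support)) = l + 1}

/-- `MC^{≤ k}`: the convexly derived measures with support of dimension at most `k`. -/
def MCdimLE (n k : ℕ) : Set (MC n) :=
  ⋃ l ∈ Finset.range (k + 1), MCdim n l

theorem vol_ne_zero {n : ℕ} {S : Set (Sphere n)} (ho : IsOpen S) (hn : S.Nonempty) :
    vol n S ≠ 0 := by
  unfold vol
  exact (ho.measure_pos _ hn).ne'

theorem vol_ne_top {n : ℕ} (S : Set (Sphere n)) : vol n S ≠ ∞ := by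
  unfold vol
  exact measure_ne_top _ S

/-- The convexly derived measure `vol|_S / vol(S)` of a nonempty open convex set `S`. -/
def uniformMeasure {n : ℕ} (S : Set (Sphere n)) (ho : IsOpen S) (hn : S.Nonempty)
    (hc : IsSphConvex S) : MC n :=
  ⟨⟨(vol n S)⁻¹ • (vol n).restrict S, ⟨by
      simp [ENNReal.inv_mul_cancel (vol_ne_zero ho hn) (vol_ne_top S)]⟩⟩,
    subset_closure ⟨S, ho, hn, hc, rfl⟩⟩

/-- A finite convex partition of the sphere: finitely many pairwise disjoint nonempty open convex
pieces, which cover the sphere up to a null set. -/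
structure FinConvexPartition (n : ℕ) where
  pieces : Finset (Set (Sphere n))
  isOpen : ∀ S ∈ pieces, IsOpen S
  nonempty : ∀ S ∈ pieces, S.Nonempty
  convex : ∀ S ∈ pieces, IsSphConvex S
  disjoint : (pieces : Set (Set (Sphere n))).PairwiseDisjoint id
  cover : vol n (⋃ S ∈ pieces, S)ᶜ = 0

/-- The atomic measure `m(Π) = ∑_S vol(S)/vol(S^n) δ_{μ_S}` on `MC` of a finite convex
partition. -/
def FinConvexPartition.atomic {n : ℕ} (P : FinConvexPartition n) : Measure (MC n) :=
  ∑ S ∈ P.pieces.attach, (vol n S.1 / vol n Set.univ) •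
    Measure.dirac (uniformMeasure S.1 (P.isOpen S.1 S.2) (P.nonempty S.1 S.2)
      (P.convex S.1 S.2))

theorem FinConvexPartition.isProbabilityMeasure_atomic {n : ℕ} (P : FinConvexPartition n) :
    IsProbabilityMeasure P.atomic := by
  have hu : vol n (Set.univ : Set (Sphere n)) ≠ 0 := vol_ne_zero isOpen_univ
    ⟨⟨EuclideanSpace.single 0 1, by simp⟩, trivial⟩
  have hsum : ∑ S ∈ P.pieces, vol n S = vol n Set.univ := by
    have h1 : vol n (⋃ S ∈ P.pieces, S) = ∑ S ∈ P.pieces, vol n S :=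
      measure_biUnion_finset P.disjoint (fun S hS => (P.isOpen S hS).measurableSet)
    rw [← h1]
    exact measure_eq_measure_of_null_sdiff (Set.subset_univ _)
      (by rw [← Set.compl_eq_univ_sdiff]; exact P.cover)
  refine ⟨?_⟩
  unfold FinConvexPartition.atomic
  simp only [Measure.coe_finsetSum, Finset.sum_apply, Measure.smul_apply, measure_univ,
    smul_eq_mul, mul_one]
  rw [Finset.sum_attach P.pieces (fun S => vol n S / vol n Set.univ)]
  simp only [div_eq_mul_inv]
  rw [← Finset.sum_mul, hsum, ENNReal.mul_inv_cancel hu (vol_ne_top _)]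

/-- The finite convex partition `P`, viewed as a probability measure on `MC`. -/
def FinConvexPartition.toProb {n : ℕ} (P : FinConvexPartition n) : ProbabilityMeasure (MC n) :=
  ⟨P.atomic, P.isProbabilityMeasure_atomic⟩

/-- The space `CP` of (infinite) convex partitions: the vague closure of the finite ones in the
space of probability measures on `MC`. -/
def CP (n : ℕ) : Set (ProbabilityMeasure (MC n)) :=
  closure (Set.range FinConvexPartition.toProb)

/-- `CP^{≤ k}`: the convex partitions supported on `MC^{≤ k}`. -/
def CPdimLE (n k : ℕ) : Set (ProbabilityMeasure (MC n)) :=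
  {P | P ∈ CP n ∧ (P : Measure (MC n)).support ⊆ MCdimLE n k}

/-- `M_r(μ)`: the points of the support of `μ` at which `x ↦ μ(B(x, r))` is maximal among the
points of the support. -/
def maxSet {n : ℕ} (r : ℝ) (μ : MC n) : Set (Sphere n) :=
  {x | x ∈ μ.toMeasure.support ∧
    ∀ y ∈ μ.toMeasure.support, μ.toMeasure (geoBall y r) ≤ μ.toMeasure (geoBall x r)}

/-- `F_r`: the convex partitions which are `r`-adapted to `f`, that is, some fibre `f⁻¹(z)` meets
the convex hull of `M_r(μ)` for every `μ` in the support of the partition. -/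
def adapted {n k : ℕ} (f : Sphere n → EuclideanSpace ℝ (Fin k)) (r : ℝ) :
    Set (ProbabilityMeasure (MC n)) :=
  {P | P ∈ CP n ∧ ∃ z : EuclideanSpace ℝ (Fin k),
    ∀ μ ∈ (P : Measure (MC n)).support, (f ⁻¹' {z} ∩ sphHull (maxSet r μ)).Nonempty}

end SphereWaist

end

/-!
Write `N = n + 1`. A convex partition disintegrates the normalized volume of the sphere
(`lintegral_lintegral_eq_of_mem_CP`), so the volume of a tube about a fibre `f⁻¹(z)` is, up to the
factor `vol(S^n)`, the mean over the partition of the masses `μ(f⁻¹(z) + ρ)`. As the tube of radius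
`c r` about an equator of codimension `l` has volume `O((c r)^l)` (`vol_tube_equator_le`), it is
enough that every `μ` in `MC^l` whose hull of `M_r(μ)` meets the fibre in a point `x` satisfies
`μ(B(x, 12 r)) ≥ γ r^l` with `γ = γ(n) > 0` (`MC.massConst_mul_pow_le`). This rests on two facts.

* Some ball of radius `r` about a point of the support of `μ` has mass at least of order `r^l`
  (`exists_le_measureReal_ball`): the support lies in the unit sphere of a space `V` of dimension
  `l + 1`, and by Fubini this is the average mass of a ball whose centre runs over a thin shell
  of `V`. Hence the balls about the points of `M_r(μ)` have at least this mass.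
* The mass persists on the hull (`MC.le_measureReal_of_mem_sphHull`). By Carathéodory a point `x` of
  the hull is a combination `∑ a i • x i` of at most `n + 2` points with nonnegative coefficients,
  and some `a j` is at least `δ = 1 / (n + 2)`, because `x` and the `x i` are unit vectors. If `μ`
  is uniform on an open convex set with cone `K`, then `p ↦ x + δ • (p - x j)` maps `K` into itself,
  because it only lowers the coefficient of `x j` by `δ` before adding `δ • p`. It carries the part
  of `K` near `x j` into the part near `x` and contracts volume by the factor `δ ^ N`
  (`hullConst_mul_vol_le`). No Brunn–Minkowski inequality is needed, as constants depending on `n`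
  are allowed. Masses of open sets are lower semicontinuous, so the estimate passes to weak limits.

The levels `MC^l` are Borel because the dimension of the support is lower semicontinuous, and the
support of a partition has full measure because `MC` is compact and metrizable, hence second
countable. The maximum is attained because `z ↦ vol(f⁻¹(z) + ρ)` is upper semicontinuous and `f` has
compact image.
-/

namespace SphereWaist

open Set Metric Filter Topology Pointwise

/-! ### Geodesic distance and volume in polar coordinates -/

theorem dist_sq_eq_cos_geoDist {n : ℕ} (x y : Sphere n) :
    dist x y ^ 2 = 2 - 2 * Real.cos (geoDist x y) := by
  have hx : ‖(x : EuclideanSpace ℝ (Fin (n + 1)))‖ = 1 := by simp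
  have hy : ‖(y : EuclideanSpace ℝ (Fin (n + 1)))‖ = 1 := by simp
  rw [Subtype.dist_eq, dist_eq_norm, geoDist, InnerProductGeometry.cos_angle, norm_sub_sq_real,
    hx, hy]
  ring

theorem geoDist_nonneg {n : ℕ} (x y : Sphere n) : 0 ≤ geoDist x y :=
  InnerProductGeometry.angle_nonneg _ _

theorem dist_le_geoDist {n : ℕ} (x y : Sphere n) : dist x y ≤ geoDist x y := by
  refine le_of_sq_le_sq ?_ (geoDist_nonneg x y)
  have h := @Real.one_sub_sq_div_two_le_cos (geoDist x y)
  rw [dist_sq_eq_cos_geoDist]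
  linarith

theorem geoDist_le_two_mul_dist {n : ℕ} (x y : Sphere n) : geoDist x y ≤ 2 * dist x y := by
  refine le_of_sq_le_sq ?_ (by positivity)
  have h0 := geoDist_nonneg x y
  have hπ : geoDist x y ≤ Real.pi := InnerProductGeometry.angle_le_pi _ _
  have h := Real.cos_le_one_sub_mul_cos_sq (x := geoDist x y) (by rwa [abs_of_nonneg h0])
  have h4 : 1 / 8 ≤ 2 / Real.pi ^ 2 := by
    rw [div_le_div_iff₀ (by norm_num) (by positivity)]
    nlinarith [Real.pi_pos, Real.pi_le_four]
  rw [mul_pow, dist_sq_eq_cos_geoDist]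
  nlinarith [mul_le_mul_of_nonneg_right h4 (sq_nonneg (geoDist x y))]

theorem geoDist_triangle {n : ℕ} (x y z : Sphere n) :
    geoDist x z ≤ geoDist x y + geoDist y z :=
  InnerProductGeometry.angle_le_angle_add_angle _ _ _

theorem continuous_geoDist {n : ℕ} :
    Continuous fun p : Sphere n × Sphere n => geoDist p.1 p.2 := by
  have h : ∀ p : Sphere n × Sphere n, geoDist p.1 p.2 =
      Real.arccos (inner ℝ (p.1 : EuclideanSpace ℝ (Fin (n + 1))) p.2) := by
    intro p
    simp [geoDist, InnerProductGeometry.angle]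
  simp only [h]
  exact Real.continuous_arccos.comp (by fun_prop)

theorem continuous_geoDist_right {n : ℕ} (x : Sphere n) : Continuous fun y => geoDist x y :=
  Continuous.uncurry_left (f := fun a b : Sphere n => geoDist a b) x continuous_geoDist

theorem isOpen_geoBall {n : ℕ} (x : Sphere n) (r : ℝ) : IsOpen (geoBall x r) :=
  isOpen_lt (continuous_geoDist_right x) continuous_const

/-- The closed geodesic ball of centre `x` and radius `r`. -/
def geoClosedBall {n : ℕ} (x : Sphere n) (r : ℝ) : Set (Sphere n) :=
  {y | geoDist x y ≤ r}

theorem isClosed_geoClosedBall {n : ℕ} (x : Sphere n) (r : ℝ) : IsClosed (geoClosedBall x r) :=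
  isClosed_le (continuous_geoDist_right x) continuous_const

theorem dist_normalize_le {F : Type*} [NormedAddCommGroup F] [NormedSpace ℝ F] {x q : F}
    (hx : ‖x‖ = 1) (hq : q ≠ 0) : ‖(‖q‖⁻¹ • q) - x‖ ≤ 2 * ‖q - x‖ := by
  have hq' : 0 < ‖q‖ := norm_pos_iff.2 hq
  have h1 : ‖(‖q‖⁻¹ • q) - q‖ ≤ ‖q - x‖ := by
    have : (‖q‖⁻¹ • q) - q = (‖q‖⁻¹ - 1) • q := by rw [sub_smul, one_smul]
    rw [this, norm_smul, Real.norm_eq_abs, ← abs_of_pos hq', ← abs_mul, sub_mul, abs_of_pos hq',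
      inv_mul_cancel₀ hq'.ne', one_mul, ← hx, abs_sub_comm]
    exact abs_norm_sub_norm_le q x
  calc _ = ‖((‖q‖⁻¹ • q) - q) + (q - x)‖ := by congr 1; abel
    _ ≤ _ := norm_add_le _ _
    _ ≤ _ := by linarith

/-- The part of the open cone over `S` in the spherical shell of radii in `[a, b)`. -/
def sector {n : ℕ} (S : Set (Sphere n)) (a b : ℝ) : Set (EuclideanSpace ℝ (Fin (n + 1))) :=
  {p | a ≤ ‖p‖ ∧ ‖p‖ < b ∧ ∃ u ∈ S, p = ‖p‖ • (u : EuclideanSpace ℝ (Fin (n + 1)))}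

theorem volume_sector {n : ℕ} {S : Set (Sphere n)} (hS : MeasurableSet S) {a b : ℝ} (ha : 0 < a)
    (hab : a ≤ b) :
    volume (sector S a b) = vol n S * ENNReal.ofReal ((b ^ (n + 1) - a ^ (n + 1)) / (n + 1)) := by
  have hb : 0 < b := ha.trans_le hab
  have hmp := Measure.measurePreserving_homeomorphUnitSphereProd
    (volume : Measure (EuclideanSpace ℝ (Fin (n + 1))))
  have hT : MeasurableSet (S ×ˢ (Iio (⟨b, hb⟩ : Ioi (0 : ℝ)) \ Iio ⟨a, ha⟩)) :=
    hS.prod (measurableSet_Iio.diff measurableSet_Iio)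
  have h1 := hmp.measure_preimage hT.nullMeasurableSet
  rw [Measure.prod_prod, measure_sdiff (Iio_subset_Iio (by exact hab))
    measurableSet_Iio.nullMeasurableSet (by
      rw [Measure.volumeIoiPow_apply_Iio]
      exact ENNReal.ofReal_ne_top),
    Measure.volumeIoiPow_apply_Iio, Measure.volumeIoiPow_apply_Iio,
    ← ENNReal.ofReal_sub _ (by positivity), ← sub_div] at h1
  simp only [finrank_euclideanSpace, Fintype.card_fin, Nat.add_sub_cancel] at h1
  rw [vol, ← h1, (MeasurableEmbedding.subtype_coe (measurableSet_singleton _).compl).comap_apply]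
  congr 1
  ext p
  simp only [sector, mem_ofPred_eq, mem_image, mem_preimage, mem_prod, Set.mem_sdiff, mem_Iio]
  constructor
  · rintro ⟨h1, h2, u, hu, h3⟩
    have hp : p ≠ 0 := by
      rintro rfl
      simp at h1
      linarith
    have hp' : 0 < ‖p‖ := norm_pos_iff.2 hp
    refine ⟨⟨p, hp⟩, ⟨?_, ?_, ?_⟩, rfl⟩
    · convert hu
      ext1
      rw [homeomorphUnitSphereProd_apply_fst_coe]
      change ‖p‖⁻¹ • p = u
      rw [inv_smul_eq_iff₀ hp'.ne']
      exact h3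
    · rw [← Subtype.coe_lt_coe, homeomorphUnitSphereProd_apply_snd_coe]
      exact h2
    · rw [← Subtype.coe_lt_coe, homeomorphUnitSphereProd_apply_snd_coe]
      exact h1.not_gt
  · rintro ⟨⟨q, hq⟩, ⟨h1, h2, h3⟩, rfl⟩
    rw [← Subtype.coe_lt_coe, homeomorphUnitSphereProd_apply_snd_coe] at h2 h3
    have hp' : 0 < ‖q‖ := norm_pos_iff.2 hq
    refine ⟨not_lt.1 h3, h2, _, h1, ?_⟩
    rw [homeomorphUnitSphereProd_apply_fst_coe, smul_smul, mul_inv_cancel₀ hp'.ne', one_smul]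

/-! ### Mass near convex combinations: open convex sets -/

instance (n : ℕ) : IsFiniteMeasure (vol n) := by
  unfold vol
  infer_instance

theorem pow_sub_pow_le_of_le_two {a b : ℝ} (ha : 0 ≤ a) (hab : a ≤ b) (hb : b ≤ 2) (N : ℕ) :
    b ^ N - a ^ N ≤ N * (b - a) * 2 ^ N := by
  induction N with
  | zero => simp
  | succ N ih =>
    have h1 : a ^ N ≤ 2 ^ N := pow_le_pow_left₀ ha (hab.trans hb) N
    have h2 : b * (b ^ N - a ^ N) ≤ 2 * (N * (b - a) * 2 ^ N) :=
      mul_le_mul hb ih (sub_nonneg.2 (pow_le_pow_left₀ ha hab N)) (by norm_num)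
    have h3 : a ^ N * (b - a) ≤ 2 ^ N * (b - a) :=
      mul_le_mul_of_nonneg_right h1 (sub_nonneg.2 hab)
    have h4 : 0 ≤ 2 ^ N * (b - a) := mul_nonneg (by positivity) (sub_nonneg.2 hab)
    push_cast
    calc b ^ (N + 1) - a ^ (N + 1) = b * (b ^ N - a ^ N) + a ^ N * (b - a) := by ring
      _ ≤ 2 * (N * (b - a) * 2 ^ N) + 2 * (2 ^ N * (b - a)) := by linarith
      _ = _ := by ring

theorem zero_mem_coneOver {n : ℕ} {S : Set (Sphere n)} (hS : S.Nonempty) :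
    (0 : EuclideanSpace ℝ (Fin (n + 1))) ∈ coneOver S :=
  ⟨0, le_rfl, hS.some, hS.some_mem, by simp⟩

theorem smul_mem_coneOver {n : ℕ} {S : Set (Sphere n)} {p : EuclideanSpace ℝ (Fin (n + 1))}
    (hp : p ∈ coneOver S) {t : ℝ} (ht : 0 ≤ t) : t • p ∈ coneOver S := by
  obtain ⟨s, hs, x, hx, rfl⟩ := hp
  exact ⟨t * s, mul_nonneg ht hs, x, hx, by rw [mul_smul]⟩

theorem add_mem_coneOver {n : ℕ} {S : Set (Sphere n)} (hc : Convex ℝ (coneOver S))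
    {p q : EuclideanSpace ℝ (Fin (n + 1))} (hp : p ∈ coneOver S) (hq : q ∈ coneOver S) :
    p + q ∈ coneOver S := by
  have h := smul_mem_coneOver (hc hp hq (by norm_num : (0 : ℝ) ≤ 1 / 2)
    (by norm_num : (0 : ℝ) ≤ 1 / 2) (by norm_num)) (by norm_num : (0 : ℝ) ≤ 2)
  convert h using 1
  module

theorem coe_mem_coneOver {n : ℕ} {S : Set (Sphere n)} {x : Sphere n} (hx : x ∈ S) :
    (x : EuclideanSpace ℝ (Fin (n + 1))) ∈ coneOver S :=
  ⟨1, zero_le_one, x, hx, by simp⟩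

theorem exists_eq_norm_smul_of_mem_coneOver {n : ℕ} {S : Set (Sphere n)}
    {p : EuclideanSpace ℝ (Fin (n + 1))} (hp : p ∈ coneOver S) (h0 : p ≠ 0) :
    ∃ u ∈ S, p = ‖p‖ • (u : EuclideanSpace ℝ (Fin (n + 1))) := by
  obtain ⟨t, ht, x, hx, rfl⟩ := hp
  refine ⟨x, hx, ?_⟩
  rw [norm_smul, norm_eq_of_mem_sphere, mul_one, Real.norm_of_nonneg ht]

/-- The constant by which mass can drop when passing from a ball about one of the points spanning
`x` to a ball about `x`, if that point has coefficient at least `δ`. -/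
noncomputable def hullConst (n : ℕ) (δ : ℝ) : ℝ :=
  δ ^ (n + 1) / (6 * (n + 1) * 2 ^ (n + 1))

/-- If `x` is close to a nonnegative combination of points `y i` of an open convex set `S` and the
coefficient of `y j` is at least `δ`, then `S` has near `x` at least a fixed fraction of its volume
near `y j`: the dilation with ratio `δ` sending `y j` to `∑ i, a i • y i` maps the cone over `S`
into itself. -/
theorem hullConst_mul_vol_le {n : ℕ} {S : Set (Sphere n)} (ho : IsOpen S)
    (hc : Convex ℝ (coneOver S)) {ι : Type*} [Fintype ι] {a : ι → ℝ}
    (ha : ∀ i, 0 ≤ a i) {y : ι → Sphere n} (hy : ∀ i, y i ∈ S) {δ r : ℝ} (hδ : 0 < δ)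
    (hδ' : δ ≤ 1 / 2) (hr : 0 < r) (hr' : r ≤ 1 / 6) {j : ι} (hj : δ ≤ a j) {z x : Sphere n}
    (hz : dist (y j) z ≤ r)
    (hx : ‖∑ i, a i • (y i : EuclideanSpace ℝ (Fin (n + 1))) - x‖ ≤ r) :
    hullConst n δ * (vol n).real (S ∩ geoBall z r) ≤
      (vol n).real (S ∩ geoClosedBall x (12 * r)) := by
  classical
  set A := sector (S ∩ geoBall z r) (1 - r) 1 with hA
  set w : EuclideanSpace ℝ (Fin (n + 1)) :=
    ∑ i, a i • (y i : EuclideanSpace ℝ (Fin (n + 1))) - δ • (y j : EuclideanSpace ℝ (Fin (n + 1)))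
    with hw
  -- the coefficients of `w` are nonnegative because `δ ≤ a j`
  have hwmem : w ∈ coneOver S := by
    have : w = ∑ i, (a i - if i = j then δ else 0) •
        (y i : EuclideanSpace ℝ (Fin (n + 1))) := by
      simp [hw, sub_smul, Finset.sum_sub_distrib, ite_smul]
    rw [this]
    refine Finset.sum_induction _ (· ∈ coneOver S) (fun _ _ => add_mem_coneOver hc)
      (zero_mem_coneOver ⟨_, hy j⟩) fun i _ => smul_mem_coneOver (coe_mem_coneOver (hy i)) ?_
    split_ifs with h
    · subst h
      linarith
    · simpa using ha i
  have hsub : (fun p => w + p) '' ((fun p => δ • p) '' A) ⊆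
      sector (S ∩ geoClosedBall x (12 * r)) (1 - 3 * r) (1 + 3 * r) := by
    rintro _ ⟨_, ⟨p, ⟨hp1, hp2, u, ⟨huS, hu⟩, hpu⟩, rfl⟩, rfl⟩
    dsimp only
    have hu1 : ‖(u : EuclideanSpace ℝ (Fin (n + 1)))‖ = 1 := norm_eq_of_mem_sphere u
    have hx1 : ‖(x : EuclideanSpace ℝ (Fin (n + 1)))‖ = 1 := norm_eq_of_mem_sphere x
    have hpu' : ‖p - u‖ ≤ r := by
      have : p - u = (‖p‖ - 1) • (u : EuclideanSpace ℝ (Fin (n + 1))) := by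
        rw [sub_smul, one_smul, ← hpu]
      rw [this, norm_smul, hu1, mul_one, Real.norm_eq_abs, abs_le]
      constructor <;> linarith
    have huz : dist u z < r := by
      rw [dist_comm]
      exact (dist_le_geoDist z u).trans_lt hu
    have huy : ‖(u : EuclideanSpace ℝ (Fin (n + 1))) - y j‖ < 2 * r := by
      rw [← dist_eq_norm, ← Subtype.dist_eq]
      have := dist_triangle u z (y j)
      rw [dist_comm z] at this
      linarith
    have hpy : ‖p - y j‖ < 3 * r := by
      have := norm_sub_le_norm_sub_add_norm_sub p u (y j : EuclideanSpace ℝ (Fin (n + 1)))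
      linarith
    set q := w + δ • p with hq
    have hqx : ‖q - x‖ < 3 * r := by
      have : q - x = (∑ i, a i • (y i : EuclideanSpace ℝ (Fin (n + 1))) - x) +
          δ • (p - y j) := by
        rw [hq, hw, smul_sub]
        abel
      rw [this]
      have h1 := norm_add_le (∑ i, a i • (y i : EuclideanSpace ℝ (Fin (n + 1))) - x)
        (δ • (p - (y j : EuclideanSpace ℝ (Fin (n + 1)))))
      rw [norm_smul, Real.norm_of_nonneg hδ.le] at h1
      nlinarith
    have habs : |‖q‖ - 1| ≤ ‖q - x‖ := by
      have := abs_norm_sub_norm_le q (x : EuclideanSpace ℝ (Fin (n + 1)))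
      rwa [hx1] at this
    rw [abs_le] at habs
    have hq0 : q ≠ 0 := by
      rw [← norm_pos_iff]
      linarith
    have hqmem : q ∈ coneOver S :=
      add_mem_coneOver hc hwmem (smul_mem_coneOver
        (hpu ▸ smul_mem_coneOver (coe_mem_coneOver huS) (norm_nonneg p)) hδ.le)
    obtain ⟨v, hv, hqv⟩ := exists_eq_norm_smul_of_mem_coneOver hqmem hq0
    refine ⟨by linarith, by linarith, v, ⟨hv, ?_⟩, hqv⟩
    have hvq : (v : EuclideanSpace ℝ (Fin (n + 1))) = ‖q‖⁻¹ • q := by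
      rw [eq_inv_smul_iff₀ (norm_ne_zero_iff.2 hq0)]
      exact hqv.symm
    have h2 := dist_normalize_le hx1 hq0
    rw [← hvq, ← dist_eq_norm, ← Subtype.dist_eq] at h2
    have h3 := geoDist_le_two_mul_dist x v
    rw [dist_comm] at h3
    change geoDist x v ≤ 12 * r
    linarith
  have hm1 : MeasurableSet (S ∩ geoBall z r) := (ho.inter (isOpen_geoBall z r)).measurableSet
  have hm2 : MeasurableSet (S ∩ geoClosedBall x (12 * r)) :=
    ho.measurableSet.inter (isClosed_geoClosedBall x _).measurableSet
  have hvolA : volume ((fun p => w + p) '' ((fun p => δ • p) '' A)) =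
      ENNReal.ofReal (δ ^ (n + 1)) * volume A := by
    rw [image_add_left, measure_preimage_add]
    have := Measure.addHaar_smul (volume : Measure (EuclideanSpace ℝ (Fin (n + 1)))) δ A
    rw [image_smul, this, finrank_euclideanSpace, Fintype.card_fin, abs_of_pos (by positivity)]
  -- compare volumes; both shells have thickness of order `r`, so the radial factors cancel
  have key := measure_mono (μ := volume) hsub
  rw [hvolA, hA, volume_sector hm1 (by linarith) (by linarith),
    volume_sector hm2 (by linarith) (by linarith)] at key
  have key2 := ENNReal.toReal_mono (ENNReal.mul_ne_top (measure_ne_top _ _) ENNReal.ofReal_ne_top)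
    key
  have hn : (0 : ℝ) < n + 1 := by positivity
  have hlow : r ≤ 1 ^ (n + 1) - (1 - r) ^ (n + 1) := by
    have : (1 - r) ^ (n + 1) ≤ (1 - r) ^ 1 :=
      pow_le_pow_of_le_one (by linarith) (by linarith) (by omega)
    rw [one_pow]
    linarith
  have hup : (1 + 3 * r) ^ (n + 1) - (1 - 3 * r) ^ (n + 1) ≤ (n + 1) * (6 * r) * 2 ^ (n + 1) := by
    have := pow_sub_pow_le_of_le_two (a := 1 - 3 * r) (b := 1 + 3 * r) (by linarith) (by linarith)
      (by linarith) (n + 1)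
    push_cast at this
    calc _ ≤ _ := this
      _ = _ := by ring
  have hup0 : 0 ≤ (1 + 3 * r) ^ (n + 1) - (1 - 3 * r) ^ (n + 1) :=
    sub_nonneg.2 (pow_le_pow_left₀ (by linarith) (by linarith) _)
  rw [ENNReal.toReal_mul, ENNReal.toReal_mul, ENNReal.toReal_mul,
    ENNReal.toReal_ofReal (by positivity), ENNReal.toReal_ofReal (div_nonneg (by linarith) hn.le),
    ENNReal.toReal_ofReal (div_nonneg hup0 hn.le)] at key2
  change δ ^ (n + 1) * ((vol n).real (S ∩ geoBall z r) * _) ≤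
    (vol n).real (S ∩ geoClosedBall x (12 * r)) * _ at key2
  set V₁ := (vol n).real (S ∩ geoBall z r)
  set V₂ := (vol n).real (S ∩ geoClosedBall x (12 * r))
  have hV₁ : 0 ≤ V₁ := measureReal_nonneg
  have hV₂ : 0 ≤ V₂ := measureReal_nonneg
  have key3 : δ ^ (n + 1) * (V₁ * (r / (n + 1))) ≤
      V₂ * (((n + 1) * (6 * r) * 2 ^ (n + 1)) / (n + 1)) := by
    refine le_trans ?_ (key2.trans ?_)
    · gcongr
    · gcongr
  have key4 : (δ ^ (n + 1) * V₁) * (r / (n + 1)) ≤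
      (V₂ * (6 * (n + 1) * 2 ^ (n + 1))) * (r / (n + 1)) := by
    calc _ = _ := by ring
      _ ≤ _ := key3
      _ = _ := by field_simp
  rw [hullConst, div_mul_eq_mul_div, div_le_iff₀ (by positivity)]
  exact le_of_mul_le_mul_right key4 (by positivity)

/-! ### Mass near convex combinations: convexly derived measures -/

/-- Lower semicontinuity of the mass of an open set under weak convergence. -/
theorem eventually_lt_measureReal {Ω : Type*} [MeasurableSpace Ω] [TopologicalSpace Ω]
    [OpensMeasurableSpace Ω] [HasOuterApproxClosed Ω] {μ : ProbabilityMeasure Ω} {G : Set Ω}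
    (hG : IsOpen G) {c : ℝ} (hc : c < (μ : Measure Ω).real G) :
    ∀ᶠ ν : ProbabilityMeasure Ω in 𝓝 μ, c < (ν : Measure Ω).real G := by
  rcases lt_or_ge c 0 with h0 | h0
  · exact Eventually.of_forall fun ν => h0.trans_le measureReal_nonneg
  · have h1 : ENNReal.ofReal c < (μ : Measure Ω) G := (ENNReal.ofReal_lt_iff_lt_toReal h0
      (measure_ne_top _ _)).2 hc
    have h2 := ProbabilityMeasure.le_liminf_measure_open_of_tendsto (L := 𝓝 μ) (μs := id)
      tendsto_id hG
    filter_upwards [eventually_lt_of_lt_liminf (h1.trans_le h2)] with ν hν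
    exact (ENNReal.ofReal_lt_iff_lt_toReal h0 (measure_ne_top _ _)).1 hν

instance {n : ℕ} (μ : MC n) : IsProbabilityMeasure μ.toMeasure := by
  unfold MC.toMeasure
  infer_instance

theorem measureReal_eq_of_uniform {n : ℕ} {ν : Measure (Sphere n)} {S : Set (Sphere n)}
    (hν : ν = (vol n S)⁻¹ • (vol n).restrict S) {T : Set (Sphere n)} (hT : MeasurableSet T) :
    ν.real T = ((vol n).real S)⁻¹ * (vol n).real (S ∩ T) := by
  rw [hν, measureReal_ennreal_smul_apply, measureReal_restrict_apply hT, ENNReal.toReal_inv,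
    inter_comm]
  rfl

/-- The mass of a convexly derived measure near a nonnegative combination `x` of points of its
support is at least a fixed fraction of its mass near a point with coefficient at least `δ`. -/
theorem MC.hullConst_mul_measureReal_le {n : ℕ} (μ : MC n) {ι : Type*} [Fintype ι] {a : ι → ℝ}
    (ha : ∀ i, 0 ≤ a i) {z : ι → Sphere n} (hz : ∀ i, z i ∈ μ.toMeasure.support) {δ r : ℝ}
    (hδ : 0 < δ) (hδ' : δ ≤ 1 / 2) (hr : 0 < r) (hr' : r ≤ 1 / 6) {j : ι} (hj : δ ≤ a j)
    {x : Sphere n}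
    (hx : ∑ i, a i • (z i : EuclideanSpace ℝ (Fin (n + 1))) = x) :
    hullConst n δ * μ.toMeasure.real (geoBall (z j) r) ≤
      μ.toMeasure.real (geoClosedBall x (12 * r)) := by
  by_contra! hlt
  have hκ : 0 < hullConst n δ := by
    unfold hullConst
    positivity
  obtain ⟨c, hc1, hc2⟩ := exists_between
    ((div_lt_iff₀' hκ).2 hlt)
  rw [div_lt_iff₀' hκ] at hc1
  have hasum : 0 ≤ ∑ i, a i := Finset.sum_nonneg fun i _ => ha i
  -- moving each `z i` by at most `η` moves the combination `x` by at most `r`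
  set η : ℝ := r / (1 + ∑ i, a i) with hη
  have hη0 : 0 < η := by positivity
  have hηr : η ≤ r := div_le_self hr.le (by linarith)
  have hηsum : (∑ i, a i) * η ≤ r := by
    rw [hη, mul_div_assoc', div_le_iff₀ (by positivity)]
    nlinarith
  have hcomp : ∀ ν : Measure (Sphere n), IsProbabilityMeasure ν →
      ν.real (geoClosedBall x (12 * r))ᶜ = 1 - ν.real (geoClosedBall x (12 * r)) :=
    fun ν _ => probReal_compl_eq_one_sub (isClosed_geoClosedBall x _).measurableSet
  have e1 := eventually_lt_measureReal (μ := μ.1) (isOpen_geoBall (z j) r) hc2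
  -- an upper bound for a closed ball is a lower bound for its open complement
  have e2 := eventually_lt_measureReal (μ := μ.1) (isClosed_geoClosedBall x (12 * r)).isOpen_compl
    (c := 1 - hullConst n δ * c) (by
      have := hcomp μ.toMeasure inferInstance
      change _ < μ.toMeasure.real _
      linarith)
  have e3 : ∀ᶠ ν : ProbabilityMeasure (Sphere n) in 𝓝 μ.1,
      ∀ i, 0 < (ν : Measure (Sphere n)).real (ball (z i) η) := by
    refine eventually_all.2 fun i => eventually_lt_measureReal isOpen_ball ?_
    exact ENNReal.toReal_pos
      (((Measure.mem_support_iff_forall _).1 (hz i) _ (ball_mem_nhds _ hη0)).ne')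
      (measure_ne_top _ _)
  have hcl : μ.1 ∈ closure (uniformConvex n) := μ.2
  obtain ⟨ν, ⟨S, ho, hn, hc, hν⟩, h1, h2, h3⟩ :=
    ((mem_closure_iff_frequently.1 hcl).and_eventually (e1.and (e2.and e3))).exists
  have hy : ∀ i, ∃ y ∈ S, dist y (z i) < η := by
    intro i
    have := h3 i
    rw [measureReal_eq_of_uniform hν isOpen_ball.measurableSet] at this
    have h4 : (vol n).real (S ∩ ball (z i) η) ≠ 0 := by
      intro h
      simp [h] at this
    obtain ⟨y, hyS, hy⟩ : (S ∩ ball (z i) η).Nonempty := by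
      by_contra h
      rw [not_nonempty_iff_eq_empty] at h
      simp [h] at h4
    exact ⟨y, hyS, hy⟩
  choose y hyS hyd using hy
  have hS0 : 0 < (vol n).real S := ENNReal.toReal_pos (vol_ne_zero ho hn) (vol_ne_top S)
  have hxy : ‖∑ i, a i • (y i : EuclideanSpace ℝ (Fin (n + 1))) - x‖ ≤ r := by
    rw [← hx, ← Finset.sum_sub_distrib]
    refine (norm_sum_le _ _).trans (le_trans ?_ hηsum)
    rw [Finset.sum_mul]
    refine Finset.sum_le_sum fun i _ => ?_
    rw [← smul_sub, norm_smul, Real.norm_of_nonneg (ha i), ← dist_eq_norm, ← Subtype.dist_eq]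
    exact mul_le_mul_of_nonneg_left (hyd i).le (ha i)
  have key := hullConst_mul_vol_le ho hc.2 ha hyS hδ hδ' hr hr' hj ((hyd j).le.trans hηr) hxy
  rw [measureReal_eq_of_uniform hν (isOpen_geoBall _ _).measurableSet] at h1
  rw [hcomp ν inferInstance, measureReal_eq_of_uniform hν
    (isClosed_geoClosedBall _ _).measurableSet] at h2
  have h5 := mul_lt_mul_of_pos_left h1 hκ
  have h6 := mul_le_mul_of_nonneg_left key (inv_pos.2 hS0).le
  linarith

/-- By Carathéodory's theorem, a point of the hull of `A` is a nonnegative combination of at most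
`n + 2` points of `A`, so that one of the coefficients is at least `1 / (n + 2)`. -/
theorem exists_combination_of_mem_sphHull {n : ℕ} {A : Set (Sphere n)} {x : Sphere n}
    (hx : x ∈ sphHull A) :
    ∃ (ι : Type) (_ : Fintype ι) (a : ι → ℝ) (z : ι → Sphere n) (j : ι), (∀ i, 0 ≤ a i) ∧
      (∀ i, z i ∈ A) ∧ 1 / ((n : ℝ) + 2) ≤ a j ∧
      ∑ i, a i • (z i : EuclideanSpace ℝ (Fin (n + 1))) = x := by
  obtain ⟨ι, _, p, w, hp, hind, hw, hw1, hsum⟩ := eq_pos_convex_span_of_mem_convexHull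
    (𝕜 := ℝ) (show (x : EuclideanSpace ℝ (Fin (n + 1))) ∈ convexHull ℝ (coneOver A) from hx)
  have hcard : Fintype.card ι ≤ n + 2 := by
    have h1 := hind.card_le_finrank_succ
    have h2 := Submodule.finrank_le (vectorSpan ℝ (range p))
    rw [finrank_euclideanSpace, Fintype.card_fin] at h2
    omega
  have hp' : ∀ i, ∃ t : ℝ, 0 ≤ t ∧ ∃ y ∈ A, p i = t • (y : EuclideanSpace ℝ (Fin (n + 1))) :=
    fun i => hp (mem_range_self i)
  choose t ht z hz hpz using hp'
  have hsum' : ∑ i, (w i * t i) • (z i : EuclideanSpace ℝ (Fin (n + 1))) = x := by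
    rw [← hsum]
    exact Finset.sum_congr rfl fun i _ => by rw [hpz, mul_smul]
  have hnn : ∀ i, 0 ≤ w i * t i := fun i => mul_nonneg (hw i).le (ht i)
  have h1 : 1 ≤ ∑ i, w i * t i := by
    calc (1 : ℝ) = ‖(x : EuclideanSpace ℝ (Fin (n + 1)))‖ := (norm_eq_of_mem_sphere x).symm
      _ ≤ ∑ i, ‖(w i * t i) • (z i : EuclideanSpace ℝ (Fin (n + 1)))‖ := by
        rw [← hsum']
        exact norm_sum_le _ _
      _ = _ := Finset.sum_congr rfl fun i _ => by
        rw [norm_smul, norm_eq_of_mem_sphere, mul_one, Real.norm_of_nonneg (hnn i)]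
  obtain ⟨j, hj⟩ : ∃ j, 1 / ((n : ℝ) + 2) ≤ w j * t j := by
    by_contra! h
    have hne : (Finset.univ : Finset ι).Nonempty := by
      by_contra h'
      rw [Finset.not_nonempty_iff_eq_empty] at h'
      rw [h', Finset.sum_empty] at h1
      linarith
    have h2 := Finset.sum_lt_sum_of_nonempty hne fun i _ => h i
    rw [Finset.sum_const, nsmul_eq_mul, Finset.card_univ] at h2
    have h3 : (Fintype.card ι : ℝ) ≤ n + 2 := by exact_mod_cast hcard
    have h4 : (Fintype.card ι : ℝ) * (1 / ((n : ℝ) + 2)) ≤ 1 := by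
      rw [mul_one_div, div_le_one (by positivity)]
      exact h3
    linarith
  exact ⟨ι, inferInstance, fun i => w i * t i, z, j, hnn, hz, hj, hsum'⟩

/-- The lower bound `m` for the masses of the balls about the points of `A` persists, up to
constants, on the convex hull of `A`. -/
theorem MC.le_measureReal_of_mem_sphHull {n : ℕ} (μ : MC n) {A : Set (Sphere n)}
    (hA : A ⊆ μ.toMeasure.support) {r m : ℝ} (hr : 0 < r) (hr' : r ≤ 1 / 6)
    (hm : ∀ z ∈ A, m ≤ μ.toMeasure.real (geoBall z r)) {x : Sphere n} (hx : x ∈ sphHull A) :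
    hullConst n (1 / (n + 2)) * m ≤ μ.toMeasure.real (geoClosedBall x (12 * r)) := by
  obtain ⟨ι, _, a, z, j, ha, hz, hj, hsum⟩ := exists_combination_of_mem_sphHull hx
  have hδ : 1 / ((n : ℝ) + 2) ≤ 1 / 2 := by
    gcongr
    linarith [n.cast_nonneg (α := ℝ)]
  refine le_trans (mul_le_mul_of_nonneg_left (hm _ (hz j)) ?_)
    (μ.hullConst_mul_measureReal_le ha (fun i => hA (hz i)) (by positivity) hδ hr hr' hj hsum)
  unfold hullConst
  positivity

/-! ### Balls of large mass about points of the support -/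

/-- If the support of a probability measure on the sphere spans a space of dimension `d`, then
some ball of radius `2 s` about a point of the support has mass at least of order `s ^ (d - 1)`.
The balls `B(p, s)` have average mass at least this, where `p` runs over the shell of radii
`(1 - s, 1 + s)` in the span. -/
theorem exists_le_measureReal_ball {n d : ℕ} (μ : Measure (Sphere n)) [IsProbabilityMeasure μ]
    (hd : Module.finrank ℝ (Submodule.span ℝ (coneOver μ.support)) = d + 1) {s : ℝ} (hs : 0 < s)
    (hs' : s ≤ 1 / 2) :
    ∃ y ∈ μ.support, s ^ d / ((d + 1) * 2 ^ (d + 3)) ≤ μ.real (ball y (2 * s)) := by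
  set V := Submodule.span ℝ (coneOver μ.support) with hV
  have hmemV : ∀ y ∈ μ.support, (y : EuclideanSpace ℝ (Fin (n + 1))) ∈ V := fun y hy =>
    Submodule.subset_span (coe_mem_coneOver hy)
  set b : ℝ := s ^ d / ((d + 1) * 2 ^ (d + 3)) with hb
  by_contra! hlt
  have : Nontrivial V := Module.nontrivial_of_finrank_pos (R := ℝ) (by rw [hd]; omega)
  set B := (volume : Measure V).real (ball 0 1) with hB
  have hB0 : 0 < B := ENNReal.toReal_pos (measure_ball_pos _ _ one_pos).ne' measure_ball_lt_top.ne
  -- if the claim fails, balls of radius `s` about points of `V` have mass at most `b`: such a ball is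
  -- null or lies in a ball of radius `2 s` about a point of the support
  have hsmall : ∀ p : V,
      μ.real {y : Sphere n | dist (p : EuclideanSpace ℝ (Fin (n + 1))) y < s} ≤ b := by
    intro p
    by_cases h :
        ({y : Sphere n | dist (p : EuclideanSpace ℝ (Fin (n + 1))) y < s} ∩ μ.support).Nonempty
    · obtain ⟨y, hy, hys⟩ := h
      refine le_trans (measureReal_mono ?_) (hlt y hys).le
      intro y' hy'
      rw [mem_ball, Subtype.dist_eq]
      have := dist_triangle_left (y' : EuclideanSpace ℝ (Fin (n + 1))) y p
      simp only [mem_ofPred_eq] at hy hy'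
      linarith
    · have h0 : μ {y : Sphere n | dist (p : EuclideanSpace ℝ (Fin (n + 1))) y < s} = 0 := by
        by_contra h'
        exact h (Measure.nonempty_inter_support_of_pos (pos_iff_ne_zero.2 h'))
      rw [measureReal_def, h0, ENNReal.toReal_zero]
      positivity
  set T : Set (V × Sphere n) := {q | dist (q.1 : EuclideanSpace ℝ (Fin (n + 1))) q.2 < s} with hT
  have hTm : MeasurableSet T := (isOpen_lt (by fun_prop) continuous_const).measurableSet
  have h1 := Measure.prod_apply (μ := (volume : Measure V)) (ν := μ) hTm
  have h2 := Measure.prod_apply_symm (μ := (volume : Measure V)) (ν := μ) hTm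
  have hvol : ∀ (p : V) {ρ : ℝ}, 0 ≤ ρ →
      volume (ball p ρ) = ENNReal.ofReal (ρ ^ (d + 1) * B) := by
    intro p ρ hρ
    rw [Measure.addHaar_ball _ _ hρ, hd, ENNReal.ofReal_mul (by positivity), hB,
      measureReal_def, ENNReal.ofReal_toReal measure_ball_lt_top.ne]
  -- the points of the support lie in `V`, where the balls about them have full volume
  have hball : ∀ y ∈ μ.support, volume ((fun p : V => (p, y)) ⁻¹' T) =
      ENNReal.ofReal (s ^ (d + 1) * B) := by
    intro y hy
    exact hvol ⟨y, hmemV y hy⟩ hs.le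
  have h3 : (volume.prod μ) T = ENNReal.ofReal (s ^ (d + 1) * B) := by
    rw [h2, lintegral_congr_ae (g := fun _ => ENNReal.ofReal (s ^ (d + 1) * B))
      (by filter_upwards [Measure.support_mem_ae (μ := μ)] with y hy using hball y hy)]
    simp
  have hann : volume (ball (0 : V) (1 + s) \ ball 0 (1 - s)) =
      ENNReal.ofReal (((1 + s) ^ (d + 1) - (1 - s) ^ (d + 1)) * B) := by
    rw [measure_sdiff (ball_subset_ball (by linarith)) measurableSet_ball.nullMeasurableSet
      measure_ball_lt_top.ne, hvol _ (by linarith), hvol _ (by linarith), sub_mul,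
      ENNReal.ofReal_sub _ (mul_nonneg (pow_nonneg (by linarith) _) hB0.le)]
  -- only centres in the shell contribute, as the support lies on the unit sphere
  have h4 : (volume.prod μ) T ≤
      ENNReal.ofReal (b * (((1 + s) ^ (d + 1) - (1 - s) ^ (d + 1)) * B)) := by
    rw [h1, ENNReal.ofReal_mul (by positivity), ← hann, ← setLIntegral_const]
    rw [← lintegral_indicator (measurableSet_ball.diff measurableSet_ball)]
    refine lintegral_mono fun p => ?_
    by_cases hp : p ∈ ball (0 : V) (1 + s) \ ball 0 (1 - s)
    · rw [indicator_of_mem hp, ← ENNReal.toReal_le_toReal (measure_ne_top _ _)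
        ENNReal.ofReal_ne_top, ENNReal.toReal_ofReal (by positivity)]
      exact hsmall p
    · have : Prod.mk p ⁻¹' T = ∅ := by
        refine eq_empty_of_forall_notMem fun y hy => hp ?_
        have hy' : dist (p : EuclideanSpace ℝ (Fin (n + 1))) y < s := hy
        have hy1 := norm_eq_of_mem_sphere y
        have h5 := abs_norm_sub_norm_le (p : EuclideanSpace ℝ (Fin (n + 1))) y
        rw [← dist_eq_norm, hy1, abs_le] at h5
        have h6 : ‖(p : EuclideanSpace ℝ (Fin (n + 1)))‖ = ‖p‖ := rfl
        rw [h6] at h5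
        rw [Set.mem_sdiff, mem_ball_zero_iff, mem_ball_zero_iff]
        constructor <;> linarith
      rw [this, measure_empty]
      exact zero_le
  rw [h3] at h4
  have hdiff : 0 ≤ (1 + s) ^ (d + 1) - (1 - s) ^ (d + 1) :=
    sub_nonneg.2 (pow_le_pow_left₀ (by linarith) (by linarith) _)
  rw [ENNReal.ofReal_le_ofReal_iff (by positivity), ← mul_assoc] at h4
  have h5 : s ^ (d + 1) ≤ b * ((1 + s) ^ (d + 1) - (1 - s) ^ (d + 1)) :=
    le_of_mul_le_mul_right h4 hB0
  have h6 := pow_sub_pow_le_of_le_two (a := 1 - s) (b := 1 + s) (by linarith) (by linarith)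
    (by linarith) (d + 1)
  have h7 : b * ((1 + s) ^ (d + 1) - (1 - s) ^ (d + 1)) ≤ s ^ (d + 1) / 2 := by
    refine (mul_le_mul_of_nonneg_left h6 (by positivity)).trans_eq ?_
    rw [hb]
    push_cast
    field_simp
    ring
  linarith [pow_pos hs (d + 1)]

/-! ### Topology and measurability on the space of convexly derived measures -/

instance (n : ℕ) : CompactSpace (MC n) :=
  isCompact_iff_compactSpace.1 (isClosed_closure (s := uniformConvex n)).isCompact

/-- The space of probability measures on the sphere is compact and metrizable, hence second
countable. -/
instance (n : ℕ) : SecondCountableTopology (MC n) := by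
  let := TopologicalSpace.pseudoMetrizableSpacePseudoMetric (ProbabilityMeasure (Sphere n))
  have : SecondCountableTopology (ProbabilityMeasure (Sphere n)) := inferInstance
  exact inferInstanceAs (SecondCountableTopology (closure (uniformConvex n)))

theorem span_coneOver {n : ℕ} (S : Set (Sphere n)) : Submodule.span ℝ (coneOver S) =
    Submodule.span ℝ ((fun x : Sphere n => (x : EuclideanSpace ℝ (Fin (n + 1)))) '' S) := by
  refine le_antisymm (Submodule.span_le.2 ?_) (Submodule.span_mono ?_)
  · rintro _ ⟨t, -, x, hx, rfl⟩
    exact Submodule.smul_mem _ _ (Submodule.subset_span ⟨x, hx, rfl⟩)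
  · rintro _ ⟨x, hx, rfl⟩
    exact coe_mem_coneOver hx

theorem le_finrank_span_coneOver_iff {n : ℕ} (S : Set (Sphere n)) (d : ℕ) :
    d ≤ Module.finrank ℝ (Submodule.span ℝ (coneOver S)) ↔ ∃ v : Fin d → Sphere n,
      (∀ i, v i ∈ S) ∧
        LinearIndependent ℝ fun i => (v i : EuclideanSpace ℝ (Fin (n + 1))) := by
  constructor
  · intro h
    rw [span_coneOver] at h
    obtain ⟨f, hf, -, hind⟩ := Submodule.exists_fun_fin_finrank_span_eq ℝ
      ((fun x : Sphere n => (x : EuclideanSpace ℝ (Fin (n + 1)))) '' S)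
    choose v hv hvf using hf
    refine ⟨fun i => v (Fin.castLE h i), fun i => hv _, ?_⟩
    simp only [hvf]
    exact hind.comp _ (Fin.castLE_injective h)
  · rintro ⟨v, hv, hind⟩
    have h1 := finrank_span_eq_card hind
    rw [Fintype.card_fin] at h1
    rw [← h1]
    refine Submodule.finrank_mono (Submodule.span_mono ?_)
    rintro _ ⟨i, rfl⟩
    exact coe_mem_coneOver (hv i)

/-- The dimension of the support is a lower semicontinuous function on `MC`. -/
theorem isOpen_setOf_le_finrank_support (n d : ℕ) :
    IsOpen {μ : MC n | d ≤ Module.finrank ℝ (Submodule.span ℝ (coneOver μ.toMeasure.support))} := by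
  simp only [le_finrank_span_coneOver_iff]
  refine isOpen_iff_mem_nhds.2 ?_
  rintro μ ⟨v, hv, hind⟩
  have hcont : Continuous fun w : Fin d → Sphere n =>
      fun i => (w i : EuclideanSpace ℝ (Fin (n + 1))) := by fun_prop
  have hopen := (isOpen_setOfPred_linearIndependent (𝕜 := ℝ)
    (E := EuclideanSpace ℝ (Fin (n + 1))) (ι := Fin d)).preimage hcont
  obtain ⟨ε, hε, hball⟩ := Metric.isOpen_iff.1 hopen v hind
  have h1 : ∀ᶠ ν : ProbabilityMeasure (Sphere n) in 𝓝 μ.1,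
      ∀ i, 0 < (ν : Measure (Sphere n)).real (ball (v i) ε) := by
    refine eventually_all.2 fun i => eventually_lt_measureReal isOpen_ball ?_
    exact ENNReal.toReal_pos
      (((Measure.mem_support_iff_forall _).1 (hv i) _ (ball_mem_nhds _ hε)).ne')
      (measure_ne_top _ _)
  have hval : Continuous fun ν : MC n => ν.1 := continuous_subtype_val
  filter_upwards [hval.continuousAt.eventually h1] with ν hν
  have h2 : ∀ i, (ball (v i) ε ∩ ν.toMeasure.support).Nonempty := fun i =>
    Measure.nonempty_inter_support_of_pos (ENNReal.toReal_pos_iff.1 (hν i)).1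
  choose w hw1 hw2 using h2
  refine ⟨w, hw2, hball ?_⟩
  rw [mem_ball, dist_pi_lt_iff hε]
  exact hw1

theorem measurableSet_MCdim (n l : ℕ) : MeasurableSet (MCdim n l) := by
  have h : MCdim n l =
      {μ : MC n | l + 1 ≤ Module.finrank ℝ (Submodule.span ℝ (coneOver μ.toMeasure.support))} \
      {μ : MC n | l + 2 ≤
        Module.finrank ℝ (Submodule.span ℝ (coneOver μ.toMeasure.support))} := by
    ext μ
    simp only [MCdim, mem_ofPred_eq, Set.mem_sdiff]
    omega
  rw [h]
  exact (isOpen_setOf_le_finrank_support n _).measurableSet.diff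
    (isOpen_setOf_le_finrank_support n _).measurableSet

/-! ### Disintegration of the volume -/

/-- A convex partition disintegrates the normalized volume of the sphere: the mean over the
partition of the integrals of a continuous function is its mean over the sphere. This is clear for
finite partitions and passes to the closure. -/
theorem lintegral_lintegral_eq_of_mem_CP {n : ℕ} {P : ProbabilityMeasure (MC n)} (hP : P ∈ CP n)
    (φ : BoundedContinuousFunction (Sphere n) NNReal) :
    ∫⁻ μ, ∫⁻ y, φ y ∂μ.toMeasure ∂(P : Measure (MC n)) =
      (vol n univ)⁻¹ * ∫⁻ y, φ y ∂(vol n) := by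
  have hcont : Continuous fun μ : MC n => μ.1.toFiniteMeasure.testAgainstNN φ :=
    (ProbabilityMeasure.continuous_testAgainstNN_eval φ).comp
      (continuous_subtype_val : Continuous fun ν : MC n => ν.1)
  let Φ : C(MC n, NNReal) := ⟨_, hcont⟩
  have hΦ : ∀ μ : MC n, (Φ μ : ℝ≥0∞) = ∫⁻ y, φ y ∂μ.toMeasure := fun μ =>
    FiniteMeasure.testAgainstNN_coe_eq
  simp only [← hΦ]
  have hclosed : IsClosed {Q : ProbabilityMeasure (MC n) |
      ∫⁻ μ, Φ μ ∂(Q : Measure (MC n)) = (vol n univ)⁻¹ * ∫⁻ y, φ y ∂(vol n)} :=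
    isClosed_eq (ProbabilityMeasure.continuous_lintegral_continuousMap Φ) continuous_const
  refine closure_minimal ?_ hclosed hP
  rintro _ ⟨Q, rfl⟩
  change ∫⁻ μ, Φ μ ∂Q.atomic = _
  have hm : Measurable fun μ => (Φ μ : ℝ≥0∞) := (Φ.continuous.measurable).coe_nnreal_ennreal
  have hunion : (vol n).restrict (⋃ S ∈ Q.pieces, S) = vol n :=
    Measure.restrict_eq_self_of_ae_mem (by
      rw [ae_iff]
      exact Q.cover)
  have hsum : ∫⁻ y, φ y ∂(vol n) = ∑ S ∈ Q.pieces.attach, ∫⁻ y in S.1, φ y ∂(vol n) := by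
    rw [Finset.sum_attach Q.pieces (fun S => ∫⁻ y in S, φ y ∂(vol n))]
    nth_rewrite 1 [← hunion]
    exact lintegral_biUnion_finset Q.disjoint (fun S hS => (Q.isOpen S hS).measurableSet) _
  rw [hsum, Finset.mul_sum, FinConvexPartition.atomic, lintegral_finsetSum_measure]
  refine Finset.sum_congr rfl fun S _ => ?_
  rw [lintegral_smul_measure, lintegral_dirac' _ hm, hΦ]
  change vol n S.1 / vol n univ *
    ∫⁻ y, φ y ∂((vol n S.1)⁻¹ • (vol n).restrict S.1) = _
  rw [lintegral_smul_measure, smul_eq_mul, ← mul_assoc, div_eq_mul_inv,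
    mul_right_comm (vol n S.1),
    ENNReal.mul_inv_cancel (vol_ne_zero (Q.isOpen _ S.2) (Q.nonempty _ S.2)) (vol_ne_top _),
    one_mul]

/-! ### Volumes of tubes -/

/-- The tube of radius `ρ` about an equator of codimension `l` has volume of order at most
`ρ ^ l`, since the cone over it lies in a box with `l` sides of length `2 ρ`. -/
theorem vol_tube_equator_le {n l : ℕ} (hl : l ≤ n) {ρ : ℝ} (hρ : 0 < ρ) :
    (vol n).real (tube (equator n (n - l)) ρ) ≤ (n + 1) * (2 ^ (n + 1) * ρ ^ l) := by
  set F : Set (Sphere n) :=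
    {y | ∀ i : Fin (n + 1), n - l < (i : ℕ) → |(y : EuclideanSpace ℝ (Fin (n + 1))) i| ≤ ρ}
    with hF
  have hsub : tube (equator n (n - l)) ρ ⊆ F := by
    rintro y ⟨x, hx, hxy⟩ i hi
    have h1 := PiLp.norm_apply_le
      ((y : EuclideanSpace ℝ (Fin (n + 1))) - (x : EuclideanSpace ℝ (Fin (n + 1)))) i
    rw [PiLp.sub_apply, hx i hi, sub_zero, Real.norm_eq_abs, ← dist_eq_norm, ← Subtype.dist_eq,
      dist_comm] at h1
    exact h1.trans ((dist_le_geoDist x y).trans hxy)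
  have hFc : IsClosed F := by
    simp only [hF, ofPred_forall]
    exact isClosed_iInter fun i => isClosed_iInter fun _ =>
      isClosed_le (by fun_prop) continuous_const
  set c : Fin (n + 1) → ℝ := fun i => if n - l < (i : ℕ) then ρ else 1 with hc
  have hc0 : ∀ i, 0 < c i := fun i => by
    simp only [hc]
    split_ifs <;> positivity
  set box : Set (Fin (n + 1) → ℝ) := univ.pi fun i => Icc (-c i) (c i)
  have hcone : (Ioo (0 : ℝ) 1 • ((↑) '' F : Set (EuclideanSpace ℝ (Fin (n + 1))))) ⊆
      WithLp.ofLp ⁻¹' box := by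
    rintro _ ⟨t, ht, _, ⟨y, hy, rfl⟩, rfl⟩ i -
    have h1 : |(y : EuclideanSpace ℝ (Fin (n + 1))) i| ≤ c i := by
      simp only [hc]
      split_ifs with h
      · exact hy i h
      · have := PiLp.norm_apply_le (y : EuclideanSpace ℝ (Fin (n + 1))) i
        rwa [norm_eq_of_mem_sphere] at this
    change t * (y : EuclideanSpace ℝ (Fin (n + 1))) i ∈ Icc (-c i) (c i)
    rw [mem_Icc, ← abs_le, abs_mul, abs_of_pos ht.1]
    exact (mul_le_of_le_one_left (abs_nonneg _) ht.2.le).trans h1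
  have hprod : ∏ i, (2 * c i) = 2 ^ (n + 1) * ρ ^ l := by
    have hcard : (Finset.univ.filter fun i : Fin (n + 1) => n - l < (i : ℕ)).card = l := by
      have h1 : (Finset.univ.filter fun i : Fin (n + 1) => n - l < (i : ℕ)) =
          Finset.Ioi (⟨n - l, by omega⟩ : Fin (n + 1)) := by
        ext i
        simp [Fin.lt_def]
      rw [h1, Fin.card_Ioi]
      simp only
      omega
    rw [Finset.prod_mul_distrib, Finset.prod_const, Finset.card_univ, Fintype.card_fin]
    simp only [hc]
    rw [Finset.prod_ite, Finset.prod_const, Finset.prod_const, hcard, one_pow, mul_one]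
  have hvol : vol n F ≤ ENNReal.ofReal ((n + 1) * (2 ^ (n + 1) * ρ ^ l)) := by
    rw [vol, Measure.toSphere_apply' _ hFc.measurableSet, finrank_euclideanSpace, Fintype.card_fin,
      ENNReal.ofReal_mul (by positivity)]
    refine mul_le_mul' ?_ ((measure_mono hcone).trans ?_)
    · rw [← Nat.cast_succ, ENNReal.ofReal_natCast]
    · rw [(PiLp.volume_preserving_ofLp (Fin (n + 1))).measure_preimage
        (MeasurableSet.univ_pi fun _ => measurableSet_Icc).nullMeasurableSet, volume_pi_pi,
        ← hprod, ENNReal.ofReal_prod_of_nonneg fun i _ => by linarith [hc0 i]]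
      refine Finset.prod_le_prod' fun i _ => ?_
      rw [Real.volume_Icc]
      exact ENNReal.ofReal_le_ofReal (by linarith)
  exact ENNReal.toReal_le_of_le_ofReal (by positivity) ((measure_mono hsub).trans hvol)

/-- The volume of the tube about a fibre is upper semicontinuous in the value: the tubes about
nearby fibres lie in any given neighbourhood of the tube about a fibre. -/
theorem upperSemicontinuous_vol_tube_fiber {n : ℕ} {Z : Type*} [TopologicalSpace Z] [T2Space Z]
    {f : Sphere n → Z} (hf : Continuous f) (ρ : ℝ) :
    UpperSemicontinuous fun z => vol n (tube (f ⁻¹' {z}) ρ) := by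
  intro z c hc
  obtain ⟨U, hU, hUo, hUc⟩ := Set.exists_isOpen_lt_of_lt _ _ hc
  -- the values whose tubes leave `U` form the image of a compact set
  set C : Set (Sphere n × Sphere n) := {q | q.2 ∈ Uᶜ ∧ geoDist q.1 q.2 ≤ ρ} with hC
  have hCc : IsCompact C := ((hUo.isClosed_compl.preimage continuous_snd).inter
    (isClosed_le continuous_geoDist continuous_const)).isCompact
  have hCf : IsClosed ((fun q : Sphere n × Sphere n => f q.1) '' C) :=
    (hCc.image (hf.comp continuous_fst)).isClosed
  have hz : z ∉ (fun q : Sphere n × Sphere n => f q.1) '' C := by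
    rintro ⟨⟨x, y⟩, ⟨hyU, hxy⟩, hxz⟩
    exact hyU (hU ⟨x, hxz, hxy⟩)
  filter_upwards [hCf.isOpen_compl.mem_nhds hz] with z' hz'
  refine lt_of_le_of_lt (measure_mono ?_) hUc
  rintro y ⟨x, hx, hxy⟩
  by_contra hy
  exact hz' ⟨(x, y), ⟨hy, hxy⟩, hx⟩

theorem exists_isGreatest_vol_tube_fiber {n : ℕ} {Z : Type*} [TopologicalSpace Z] [T2Space Z]
    {f : Sphere n → Z} (hf : Continuous f) (ρ : ℝ) :
    ∃ M, IsGreatest (range fun z => (vol n).real (tube (f ⁻¹' {z}) ρ)) M := by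
  have : Nonempty (Sphere n) := ⟨⟨EuclideanSpace.single 0 1, by simp⟩⟩
  obtain ⟨z, -, hz⟩ := UpperSemicontinuousOn.exists_isMaxOn (range_nonempty f)
    (isCompact_range hf) ((upperSemicontinuous_vol_tube_fiber hf ρ).upperSemicontinuousOn _)
  refine ⟨_, ⟨z, rfl⟩, ?_⟩
  rintro _ ⟨z', rfl⟩
  refine ENNReal.toReal_mono (vol_ne_top _) ?_
  by_cases h : z' ∈ range f
  · exact hz h
  -- off the image of `f` the fibre and its tube are empty
  · have : tube (f ⁻¹' {z'}) ρ = ∅ := by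
      refine eq_empty_of_forall_notMem ?_
      rintro y ⟨x, hx, -⟩
      exact h ⟨x, hx⟩
    rw [this, measure_empty]
    exact zero_le

/-! ### Lower bound for tubes about fibres -/

/-- The constant in the lower bound for the mass that a convexly derived measure has near the hull
of its points of maximal mass. -/
noncomputable def massConst (n : ℕ) : ℝ :=
  hullConst n (1 / (n + 2)) * (1 / (4 ^ n * ((n + 1) * 2 ^ (n + 3))))

theorem massConst_pos (n : ℕ) : 0 < massConst n := by
  unfold massConst hullConst
  positivity

/-- A convexly derived measure with `l`-dimensional support has mass at least of order `r ^ l` near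
every point of the hull of `M_r(μ)`. -/
theorem MC.massConst_mul_pow_le {n l : ℕ} (hl : l ≤ n) {μ : MC n} (hμ : μ ∈ MCdim n l) {r : ℝ}
    (hr : 0 < r) (hr' : r ≤ 1 / 6) {x : Sphere n} (hx : x ∈ sphHull (maxSet r μ)) :
    massConst n * r ^ l ≤ μ.toMeasure.real (geoClosedBall x (12 * r)) := by
  obtain ⟨y, hy, hmass⟩ := exists_le_measureReal_ball μ.toMeasure hμ (s := r / 4) (by positivity)
    (by linarith)
  have hball : ball y (2 * (r / 4)) ⊆ geoBall y r := by
    intro y' hy'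
    rw [mem_ball, dist_comm] at hy'
    exact (geoDist_le_two_mul_dist y y').trans_lt (by linarith)
  have hlow : 1 / (4 ^ n * (((n : ℝ) + 1) * 2 ^ (n + 3))) * r ^ l ≤
      μ.toMeasure.real (geoBall y r) := by
    refine le_trans ?_ (hmass.trans (measureReal_mono hball))
    rw [div_pow, div_div, div_mul_eq_mul_div, one_mul]
    have hln : (l : ℝ) ≤ n := by exact_mod_cast hl
    gcongr <;> norm_num
  rw [massConst, mul_assoc]
  refine μ.le_measureReal_of_mem_sphHull (A := maxSet r μ) (fun z hz => hz.1) hr hr'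
    (fun z hz => hlow.trans ?_) hx
  exact ENNReal.toReal_mono (measure_ne_top _ _) (hz.2 y hy)

theorem pairwise_disjoint_MCdim (n : ℕ) : Pairwise (Function.onFun Disjoint (MCdim n)) := by
  intro i j hij
  refine Set.disjoint_left.2 fun μ hi hj => hij ?_
  have h1 : Module.finrank ℝ (Submodule.span ℝ (coneOver μ.toMeasure.support)) = i + 1 := hi
  have h2 : Module.finrank ℝ (Submodule.span ℝ (coneOver μ.toMeasure.support)) = j + 1 := hj
  omega

/-- If almost all measures of a convex partition with `l`-dimensional support give a tube about `A`
mass at least `g l`, then the volume of a slightly larger tube is at least the mean of these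
bounds. -/
theorem sum_mul_measureReal_MCdim_le {n : ℕ} {P : ProbabilityMeasure (MC n)} (hP : P ∈ CP n)
    {A : Set (Sphere n)} {ρ ε : ℝ} (hε : 0 < ε) (L : Finset ℕ) {g : ℕ → ℝ} (hg : ∀ l ∈ L, 0 ≤ g l)
    (h : ∀ l ∈ L, ∀ μ ∈ (P : Measure (MC n)).support, μ ∈ MCdim n l →
      g l ≤ μ.toMeasure.real (tube A ρ)) :
    (vol n).real univ * ∑ l ∈ L, g l * (P : Measure (MC n)).real (MCdim n l) ≤
      (vol n).real (tube A (ρ + 2 * ε)) := by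
  set φ := thickenedIndicator hε (tube A ρ) with hφ
  have hlow : ∀ μ : Measure (Sphere n), μ (tube A ρ) ≤ ∫⁻ y, φ y ∂μ := by
    intro μ
    have h1 := mul_meas_ge_le_lintegral (μ := μ)
      (φ.continuous.measurable.coe_nnreal_ennreal) 1
    rw [one_mul] at h1
    refine le_trans (measure_mono fun y hy => ?_) h1
    change (1 : ℝ≥0∞) ≤ φ y
    rw [hφ, thickenedIndicator_one hε _ hy, ENNReal.coe_one]
  have hup : ∫⁻ y, φ y ∂(vol n) ≤ vol n (tube A (ρ + 2 * ε)) := by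
    refine le_trans (lintegral_mono fun y => ?_) (lintegral_indicator_one_le _)
    by_cases hy : y ∈ tube A (ρ + 2 * ε)
    · rw [indicator_of_mem hy, Pi.one_apply, ← ENNReal.coe_one, ENNReal.coe_le_coe]
      exact thickenedIndicator_le_one hε _ y
    · rw [hφ, thickenedIndicator_zero hε _ fun hy' => hy ?_]
      · simp
      · obtain ⟨x, ⟨a, ha, hax⟩, hxy⟩ := mem_thickening_iff.1 hy'
        refine ⟨a, ha, (geoDist_triangle a x y).trans ?_⟩
        have := geoDist_le_two_mul_dist x y
        rw [dist_comm] at this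
        linarith
  have hsum : ∑ l ∈ L, ENNReal.ofReal (g l) * (P : Measure (MC n)) (MCdim n l) ≤
      ∫⁻ μ, ∫⁻ y, φ y ∂μ.toMeasure ∂(P : Measure (MC n)) := by
    refine le_trans ?_ (setLIntegral_le_lintegral (⋃ l ∈ L, MCdim n l) _)
    rw [lintegral_biUnion_finset ((pairwise_disjoint_MCdim n).set_pairwise _)
      fun l _ => measurableSet_MCdim n l]
    refine Finset.sum_le_sum fun l hl => ?_
    rw [← setLIntegral_const]
    refine lintegral_mono_ae ?_
    filter_upwards [ae_restrict_mem (measurableSet_MCdim n l),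
      ae_restrict_of_ae (Measure.support_mem_ae (μ := (P : Measure (MC n))))] with μ h1 h2
    refine le_trans ?_ (hlow μ.toMeasure)
    rw [ENNReal.ofReal_le_iff_le_toReal (measure_ne_top _ _)]
    exact h l hl μ h2 h1
  have hu0 : vol n univ ≠ 0 := vol_ne_zero isOpen_univ
    ⟨⟨EuclideanSpace.single 0 1, by simp⟩, trivial⟩
  rw [lintegral_lintegral_eq_of_mem_CP hP, ← ENNReal.mul_le_iff_le_inv hu0 (vol_ne_top _)] at hsum
  have hfin := ENNReal.toReal_mono (vol_ne_top _) (hsum.trans hup)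
  rw [ENNReal.toReal_mul, ENNReal.toReal_sum fun l _ =>
    ENNReal.mul_ne_top ENNReal.ofReal_ne_top (measure_ne_top _ _)] at hfin
  refine le_trans (le_of_eq ?_) hfin
  congr 1
  refine Finset.sum_congr rfl fun l hl => ?_
  rw [ENNReal.toReal_mul, ENNReal.toReal_ofReal (hg l hl)]
  rfl

theorem tube_mono {n : ℕ} (A : Set (Sphere n)) {ρ ρ' : ℝ} (h : ρ ≤ ρ') : tube A ρ ⊆ tube A ρ' :=
  fun _ ⟨x, hx, hxy⟩ => ⟨x, hx, hxy.trans h⟩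

end SphereWaist

theorem mainTheorem4 (n : ℕ) :
    ∃ c : ℝ, 0 < c ∧ ∃ r₀ : ℝ, 0 < r₀ ∧
      ∀ k : ℕ, k ≤ n →
      ∀ f : SphereWaist.Sphere n → EuclideanSpace ℝ (Fin k), Continuous f →
      ∀ r : ℝ, 0 < r → r ≤ r₀ →
      ∀ P : ProbabilityMeasure (SphereWaist.MC n),
        P ∈ SphereWaist.adapted f r → P ∈ SphereWaist.CPdimLE n k →
        ∃ M : ℝ,
          IsGreatest (Set.range fun z : EuclideanSpace ℝ (Fin k) =>
            (SphereWaist.vol n).real (SphereWaist.tube (f ⁻¹' {z}) (r / c))) M ∧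
          c * ∑ l ∈ Finset.range (k + 1),
              (SphereWaist.vol n).real (SphereWaist.tube (SphereWaist.equator n (n - l)) (c * r)) *
                (P : Measure (SphereWaist.MC n)).real (SphereWaist.MCdim n l) ≤ M := by
  open SphereWaist in
  set V := (vol n).real Set.univ
  have hV0 : 0 < V := ENNReal.toReal_pos
    (vol_ne_zero isOpen_univ ⟨⟨EuclideanSpace.single 0 1, by simp⟩, trivial⟩) (vol_ne_top _)
  have hγ := massConst_pos n
  -- `1 / 14` makes room for the tube of radius `12 r + 2 r`, the other bound compares constants
  set c : ℝ := min (1 / 14) (V * massConst n / ((n + 1) * 2 ^ (n + 1))) with hc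
  have hc0 : 0 < c := lt_min (by norm_num) (by positivity)
  have hc1 : c ≤ 1 / 14 := min_le_left _ _
  have hc2 : c * ((n + 1) * 2 ^ (n + 1)) ≤ V * massConst n := by
    rw [← le_div_iff₀ (by positivity)]
    exact min_le_right _ _
  refine ⟨c, hc0, 1 / 6, by norm_num, fun k hk f hf r hr hr' P ⟨hP, z, hz⟩ _ => ?_⟩
  obtain ⟨M, hM⟩ := exists_isGreatest_vol_tube_fiber hf (r / c)
  refine ⟨M, hM, ?_⟩
  have hkey := sum_mul_measureReal_MCdim_le hP (A := f ⁻¹' {z}) (ρ := 12 * r) hr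
    (Finset.range (k + 1)) (g := fun l => massConst n * r ^ l) (fun l _ => by positivity) (by
      intro l hl μ hμ hμl
      obtain ⟨x, hxf, hx⟩ := hz μ hμ
      have hln : l ≤ n := (Nat.lt_succ_iff.1 (Finset.mem_range.1 hl)).trans hk
      exact (MC.massConst_mul_pow_le hln hμl hr hr' hx).trans
        (measureReal_mono fun y hy => ⟨x, hxf, hy⟩))
  have htube : (vol n).real (tube (f ⁻¹' {z}) (12 * r + 2 * r)) ≤ M := by
    refine le_trans (measureReal_mono (tube_mono _ ?_)) (hM.2 ⟨z, rfl⟩)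
    rw [le_div_iff₀ hc0]
    nlinarith
  refine le_trans ?_ (hkey.trans htube)
  rw [Finset.mul_sum, Finset.mul_sum]
  refine Finset.sum_le_sum fun l hl => ?_
  rw [← mul_assoc, ← mul_assoc]
  refine mul_le_mul_of_nonneg_right ?_ measureReal_nonneg
  have hln : l ≤ n := (Nat.lt_succ_iff.1 (Finset.mem_range.1 hl)).trans hk
  have hpow : (c * r) ^ l ≤ r ^ l :=
    pow_le_pow_left₀ (by positivity) (by nlinarith) l
  calc c * (vol n).real (tube (equator n (n - l)) (c * r))
      ≤ c * ((n + 1) * (2 ^ (n + 1) * (c * r) ^ l)) := by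
        gcongr
        exact vol_tube_equator_le hln (by positivity)
    _ ≤ c * ((n + 1) * (2 ^ (n + 1) * r ^ l)) := by gcongr
    _ = (c * ((n + 1) * 2 ^ (n + 1))) * r ^ l := by ring
    _ ≤ (V * massConst n) * r ^ l := by gcongr
    _ = _ := by ring
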